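/- Let $\nu$ be a probability distribution on $\mathbb{R}$ with finite fourth moment, mean $\mu$, variance $\sigma^2>0$ (with $\sigma>0$), skewness $\gamma=\mathbb{E}[(Y-\mu)^3]/\sigma^3$ and (non-excess) kurtosis $\kappa=\mathbb{E}[(Y-\mu)^4]/\sigma^4$, where $Y\sim\nu$. For every dimension $d$, let $X_1,\dots,X_N$ be i.i.d. random vectors in $\mathbb{R}^d$ whose coordinates are i.i.d. with law $\nu$; let $N$, $k \ge 2$, the set $\mathcal{U}$ of $k$ of these vectors, $u_{\mathrm{in}}\in\mathcal{U}$ and $u_{\mathrm{out}}\notin\mathcal{U}$ (another one of the $N$ vectors) be fixed by indices not depending on $d$. Put $\mu_{\mathcal{U}}=\frac1k\sum_{u\in\mathcal{U}}u$, $s(x,y)=\sum_{j=1}^d x_jy_j$, $s_{\mathrm{in}}=s(u_{\mathrm{in}},\mu_{\mathcal{U}})$ and $s_{\mathrm{out}}=s(u_{\mathrm{out}},\mu_{\mathcal{U}})$. Then: 1. $s_{\mathrm{in}}$ and $s_{\mathrm{out}}$ are square-integrable, with $$\mathbb{E}[s_{\mathrm{in}}]=d\Big(\mu^2+\frac{\sigma^2}{k}\Big),\qquad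 \mathrm{Var}(s_{\mathrm{in}})=d\,\frac{k(k+3)\mu^2\sigma^2+2(k+1)\mu\gamma\sigma^3+(\kappa+k-2)\sigma^4}{k^2},$$ $$\mathbb{E}[s_{\mathrm{out}}]=d\mu^2,\qquad \mathrm{Var}(s_{\mathrm{out}})=d\,\frac{\sigma^4+(k+1)\sigma^2\mu^2}{k},\qquad \mathrm{Cov}(s_{\mathrm{in}},s_{\mathrm{out}})=d\,\frac{2k\mu^2\sigma^2+\mu\gamma\sigma^3}{k^2}.$$ For $d\ge 1$ both variances are positive. 2. As $d\to\infty$, each of $\frac{s_{\mathrm{in}}-\mathbb{E}[s_{\mathrm{in}}]}{\sqrt{\mathrm{Var}(s_{\mathrm{in}})}}$ and $\frac{s_{\mathrm{out}}-\mathbb{E}[s_{\mathrm{out}}]}{\sqrt{\mathrm{Var}(s_{\mathrm{out}})}}$ converges in distribution to $\mathcal{N}(0,1)$. Jointly, $\frac{1}{\sqrt d}\big(s_{\mathrm{in}}-\mathbb{E}[s_{\mathrm{in}}],\,s_{\mathrm{out}}-\mathbb{E}[s_{\mathrm{out}}]\big)$ converges in distribution to the centred bivariate normal distribution whose covariance matrix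 has as entries the variances and the covariance above divided by $d$. 3. For every $d\ge1$, let $p_d$ be the probability $\mathbb{P}(s_{\mathrm{in}}>s_{\mathrm{out}})$ computed under the normal approximation, i.e. when the law of the pair $(s_{\mathrm{in}},s_{\mathrm{out}})$ is replaced by the bivariate normal law with the same means, variances and covariance. Then $$p_d=\frac12\left(1+\operatorname{erf}\sqrt{\frac{d\sigma^2}{2\big((2(k-1)+\kappa)\sigma^2+2k\gamma\mu\sigma+2k^2\mu^2\big)}}\right),\qquad \operatorname{erf}(x)=\frac{2}{\sqrt\pi}\int_0^x e^{-t^2}\,dt,$$ where the expression under the square root is positive. Moreover $p_d>\frac12$ for every $d\ge1$, and $p_d$ is strictly increasing in $d$. -/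

import Mathlib

open MeasureTheory ProbabilityTheory Filter Topology

noncomputable section

namespace AvgEmbedding

/-- The Gauss error function. -/
def erf (x : ℝ) : ℝ := 2 / Real.sqrt Real.pi * ∫ t in (0 : ℝ)..x, Real.exp (-t ^ 2)

/-- Skewness of a distribution on the real line: `E[(Y - E Y)^3] / Var(Y)^(3/2)`. -/
def skewness (ν : Measure ℝ) : ℝ := centralMoment id 3 ν / Real.sqrt Var[id; ν] ^ 3

/-- Kurtosis (not the excess kurtosis) of a distribution on the real line:
`E[(Y - E Y)^4] / Var(Y)^2`. -/
def kurtosis (ν : Measure ℝ) : ℝ := centralMoment id 4 ν / Var[id; ν] ^ 2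

/-- The inner product similarity of two vectors. -/
def similarity {d : ℕ} (x y : EuclideanSpace ℝ (Fin d)) : ℝ := ∑ j, x j * y j

/-- The average of the vectors `x i`, `i ∈ U`. -/
def center {N d : ℕ} (U : Finset (Fin N)) (x : Fin N → EuclideanSpace ℝ (Fin d)) :
    EuclideanSpace ℝ (Fin d) :=
  (U.card : ℝ)⁻¹ • ∑ i ∈ U, x i

/-- The random similarity between the `i`-th embedding and the average of the embeddings
indexed by `U`. -/
def simToCenter {N d : ℕ} {Ω : Type*} (X : Fin N → Ω → EuclideanSpace ℝ (Fin d))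
    (U : Finset (Fin N)) (i : Fin N) (ω : Ω) : ℝ :=
  similarity (X i ω) (center U fun l => X l ω)

/-- The embeddings are independent random vectors, and the entries of each of them are
independent random variables with common distribution `ν`. -/
structure IsIIDEmbedding {N d : ℕ} {Ω : Type*} [MeasurableSpace Ω] (P : Measure Ω)
    (ν : Measure ℝ) (X : Fin N → Ω → EuclideanSpace ℝ (Fin d)) : Prop where
  indep : iIndepFun X P
  indep_entries : ∀ i, iIndepFun (fun (j : Fin d) (ω : Ω) => X i ω j) P
  law_entries : ∀ i j, HasLaw (fun ω => X i ω j) ν P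

/-- The normal approximation of a pair of square-integrable random variables: the bivariate
normal distribution with the same means, variances and covariance. -/
def normalApprox {Ω : Type*} [MeasurableSpace Ω] (P : Measure Ω) (S T : Ω → ℝ) :
    Measure (EuclideanSpace ℝ (Fin 2)) :=
  multivariateGaussian !₂[∫ ω, S ω ∂P, ∫ ω, T ω ∂P]
    !![Var[S; P], cov[S, T; P]; cov[S, T; P], Var[T; P]]

/-- The probability, under the normal approximation of the pair `(S, T)`, that the first
coordinate exceeds the second one. -/
def approxProbGT {Ω : Type*} [MeasurableSpace Ω] (P : Measure Ω) (S T : Ω → ℝ) : ℝ :=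
  (normalApprox P S T).real {x | x 1 < x 0}

end AvgEmbedding

end

/-! Both similarities split over coordinates: the `j`-th summand is a fixed function, `A` or `B`, of
the column formed by the `j`-th entries of all `N` vectors. The columns are i.i.d. with law `ν^N`
(`hasLaw_transpose`), so means, variances and the covariance are `d` times those for one column, and
a bivariate central limit theorem applies (`tendstoInDistribution_pair`).

In one column let `Y` be the entry of `u_in`, `S` the sum of the other `k - 1` entries of `U`, and
`Z` the entry of `u_out`. Then `A = Y(Y+S)/k` and `B = Z(Y+S)/k` with `Y, S, Z` independent, so all
moments are polynomials in the raw moments of `ν` (`moments_of_indep`, `coordSim_moments`).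
Pearson's inequality `γ² + 1 ≤ κ` gives the positivity of `Var A` and of the denominator `D` in the
erf formula.

Under the normal approximation the difference of the similarities is Gaussian with mean `a = dσ²/k`
and variance `v = dσ²D/k²`. It is positive with probability `(1 + erf(a/√(2v)))/2`, and `a²/(2v) =
dσ²/(2D)`; monotonicity of erf gives the rest. -/

namespace AvgEmbedding

/-! ### Sums over i.i.d. columns -/

section IID

variable {Ω E : Type*} [MeasurableSpace Ω] [MeasurableSpace E] {P : Measure Ω} {m : Measure E}
  {d : ℕ} {ξ : Fin d → Ω → E} {f g : E → ℝ}

/-- Independent rows with independent entries make the whole array a product measure over `ι × κ`,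
which is invariant under swapping the indices. This yields i.i.d. columns. -/
theorem hasLaw_transpose {ι κ : Type*} [Fintype ι] [Fintype κ] {Y : ι → Ω → κ → E}
    [IsProbabilityMeasure m] (h : iIndepFun Y P)
    (hY : ∀ i, iIndepFun (fun j ω => Y i ω j) P) (hm : ∀ i j, HasLaw (fun ω => Y i ω j) m P) :
    HasLaw (fun ω j i => Y i ω j) (Measure.pi fun _ : κ => Measure.pi fun _ : ι => m) P := by
  have hmeas : ∀ i, AEMeasurable (Y i) P := fun i =>
    aemeasurable_pi_lambda _ fun j => (hm i j).aemeasurable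
  have h1 : HasLaw (fun ω i j => Y i ω j)
      (Measure.pi fun _ : ι => Measure.pi fun _ : κ => m) P := by
    refine ⟨aemeasurable_pi_lambda _ hmeas, ?_⟩
    rw [h.map_fun_eq_pi_map hmeas]
    congr with i : 1
    have := (hY i).map_fun_eq_pi_map fun j => (hm i j).aemeasurable
    simp only [(hm i _).map_eq] at this
    exact this
  have h2 : HasLaw (fun (x : ι → κ → E) j i => x i j)
      (Measure.pi fun _ : κ => Measure.pi fun _ : ι => m)
      (Measure.pi fun _ : ι => Measure.pi fun _ : κ => m) := by
    have hT : Measurable fun (x : ι → κ → E) j i => x i j :=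
      measurable_pi_lambda _ fun j => measurable_pi_lambda _ fun i =>
        (measurable_pi_apply j).comp (measurable_pi_apply i)
    refine ⟨hT.aemeasurable, ?_⟩
    have e1 := Measure.infinitePi_map_curry (X := E) (fun (_ : ι) (_ : κ) => m)
    have e2 := Measure.infinitePi_map_curry (X := E) (fun (_ : κ) (_ : ι) => m)
    have e3 := Measure.map_infinitePi_infinitePi_of_inj (P := fun _ : ι × κ => m)
      (f := Prod.swap) (Prod.swap_injective (α := κ) (β := ι))
    simp only [Measure.infinitePi_eq_pi] at e1 e2 e3
    rw [← e1, ← e2, ← e3, Measure.map_map hT (by fun_prop),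
      Measure.map_map (by fun_prop) (by fun_prop)]
    rfl
  exact h2.fun_comp h1

theorem memLp_sum_comp (hl : ∀ j, HasLaw (ξ j) m P) (hf : MemLp f 2 m) :
    MemLp (fun ω => ∑ j, f (ξ j ω)) 2 P := by
  refine memLp_finsetSum _ fun j _ => ?_
  rw [← (hl j).map_eq] at hf
  exact hf.comp_of_map (hl j).aemeasurable

theorem integral_sum_comp (hl : ∀ j, HasLaw (ξ j) m P) (hf : Integrable f m) :
    ∫ ω, ∑ j, f (ξ j ω) ∂P = d * ∫ x, f x ∂m := by
  have hi : ∀ j, Integrable (fun ω => f (ξ j ω)) P := fun j => by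
    have hf' := hf
    rw [← (hl j).map_eq] at hf'
    exact hf'.comp_aemeasurable (hl j).aemeasurable
  have he : ∀ j, ∫ ω, f (ξ j ω) ∂P = ∫ x, f x ∂m := fun j =>
    (hl j).integral_comp hf.aestronglyMeasurable
  rw [integral_finsetSum _ fun j _ => hi j]
  simp [he]

theorem covariance_sum_comp [IsProbabilityMeasure P] (h : iIndepFun ξ P)
    (hl : ∀ j, HasLaw (ξ j) m P) (hf : MemLp f 2 m) (hg : MemLp g 2 m)
    (hfm : Measurable f) (hgm : Measurable g) :
    cov[fun ω => ∑ j, f (ξ j ω), fun ω => ∑ j, g (ξ j ω); P] = d * cov[f, g; m] := by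
  have hL : ∀ {f : E → ℝ}, MemLp f 2 m → ∀ j, MemLp (fun ω => f (ξ j ω)) 2 P := by
    intro f hf j
    rw [← (hl j).map_eq] at hf
    exact hf.comp_of_map (hl j).aemeasurable
  rw [covariance_fun_sum_fun_sum (hL hf) (hL hg)]
  have hij : ∀ i j, cov[fun ω => f (ξ i ω), fun ω => g (ξ j ω); P]
      = if i = j then cov[f, g; m] else 0 := by
    intro i j
    split_ifs with hij
    · subst hij
      exact (hl i).covariance_fun_comp hfm.aemeasurable hgm.aemeasurable
    · exact ((h.indepFun hij).comp hfm hgm).covariance_eq_zero (hL hf i) (hL hg j)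
  simp [hij]

theorem charFun_map_sum_comp (h : iIndepFun ξ P) (hl : ∀ j, HasLaw (ξ j) m P)
    (hfm : Measurable f) (t : ℝ) :
    charFun (P.map fun ω => ∑ j, f (ξ j ω)) t = charFun (m.map f) t ^ d := by
  have h' : iIndepFun (fun j ω => f (ξ j ω)) P := h.comp (fun _ => f) fun _ => hfm
  rw [iIndepFun.charFun_map_fun_sum_eq_prod (X := fun j ω => f (ξ j ω)) (hX := h')
    fun j => hfm.comp_aemeasurable (hl j).aemeasurable]
  have he : ∀ j, P.map (fun ω => f (ξ j ω)) = m.map f := fun j => by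
    rw [← (hl j).map_eq, AEMeasurable.map_map_of_aemeasurable hfm.aemeasurable (hl j).aemeasurable]
    rfl
  simp [he]

/-- The unit-variance limit is applied to `f / √Var f` at the argument `√Var f`, so the scaling
cancels. If the variance is zero, `f` vanishes almost everywhere. -/
theorem tendsto_charFun_inv_sqrt_pow [IsProbabilityMeasure m] (hf : MemLp f 2 m)
    (h0 : ∫ x, f x ∂m = 0) :
    Tendsto (fun n : ℕ => charFun (m.map f) (Real.sqrt n)⁻¹ ^ n) atTop
      (𝓝 (Complex.exp (-(Var[f; m] : ℝ) / 2))) := by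
  by_cases hv : Var[f; m] = 0
  · have hz : f =ᵐ[m] fun _ => 0 := by
      filter_upwards [ae_eq_integral_of_variance_eq_zero hf hv] with x hx
      rw [hx, h0]
    rw [Measure.map_congr hz, hv]
    simp
  · have hs : Real.sqrt Var[f; m] ≠ 0 := by
      rw [Real.sqrt_ne_zero (variance_nonneg _ _)]
      exact hv
    have key := tendsto_charFun_inv_sqrt_mul_pow (P := m)
      (X := fun x => (Real.sqrt Var[f; m])⁻¹ * f x) (hf.aemeasurable.const_mul _)
      (by rw [integral_const_mul, h0, mul_zero])
      (by
        have : (fun x => (Real.sqrt Var[f; m])⁻¹ * f x) ^ 2 =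
            fun x => (Var[f; m])⁻¹ * f x ^ 2 := by
          ext x
          simp [mul_pow, inv_pow, Real.sq_sqrt (variance_nonneg _ _)]
        rw [this, integral_const_mul, ← variance_of_integral_eq_zero hf.aemeasurable h0,
          inv_mul_cancel₀ hv]) (Real.sqrt Var[f; m])
    simp only [charFun_map_mul_comp hf.aemeasurable] at key
    convert key using 3 with n
    · congr 1
      field_simp
    · rw [← Complex.ofReal_pow, Real.sq_sqrt (variance_nonneg _ _)]

end IID

/-! ### Moments of products of independent variables -/

section Moments

variable {Ω : Type*} [MeasurableSpace Ω] {m : Measure Ω} {Y S Z : Ω → ℝ}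

theorem integrable_pow_of_memLp [IsFiniteMeasure m] {n a : ℕ} (hY : MemLp Y n m) (ha : a ≤ n) :
    Integrable (fun ω => Y ω ^ a) m := by
  have h := (hY.mono_exponent (p := (a : ENNReal)) (by exact_mod_cast ha)).integrable_norm_pow'
  exact (integrable_norm_iff (hY.aestronglyMeasurable.pow a)).1 (by simpa using h)

theorem integrable_monomial (hYS : IndepFun Y S m) (hZ : IndepFun (fun ω => (Y ω, S ω)) Z m)
    (a b c : ℕ) (ha : Integrable (fun ω => Y ω ^ a) m) (hb : Integrable (fun ω => S ω ^ b) m)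
    (hc : Integrable (fun ω => Z ω ^ c) m) :
    Integrable (fun ω => Y ω ^ a * S ω ^ b * Z ω ^ c) m ∧
    ∫ ω, Y ω ^ a * S ω ^ b * Z ω ^ c ∂m
      = (∫ ω, Y ω ^ a ∂m) * (∫ ω, S ω ^ b ∂m) * ∫ ω, Z ω ^ c ∂m := by
  have h1 : IndepFun (fun ω => Y ω ^ a) (fun ω => S ω ^ b) m :=
    hYS.comp (φ := fun x : ℝ => x ^ a) (ψ := fun x : ℝ => x ^ b) (by fun_prop) (by fun_prop)
  have h2 : IndepFun (fun ω => Y ω ^ a * S ω ^ b) (fun ω => Z ω ^ c) m :=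
    hZ.comp (φ := fun p : ℝ × ℝ => p.1 ^ a * p.2 ^ b) (ψ := fun x : ℝ => x ^ c)
      (by fun_prop) (by fun_prop)
  have i1 : Integrable (fun ω => Y ω ^ a * S ω ^ b) m := h1.integrable_mul ha hb
  refine ⟨h2.integrable_mul i1 hc, ?_⟩
  rw [h2.integral_fun_mul_eq_mul_integral i1.aestronglyMeasurable hc.aestronglyMeasurable,
    h1.integral_fun_mul_eq_mul_integral ha.aestronglyMeasurable hb.aestronglyMeasurable]

/-- Means, variances and covariance of `c Y (Y + S)` and `c Z (Y + S)` for independent `Y, S, Z`. -/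
theorem moments_of_indep [IsProbabilityMeasure m] (hYS : IndepFun Y S m)
    (hZ : IndepFun (fun ω => (Y ω, S ω)) Z m) (hYL : MemLp Y 4 m) (hSL : MemLp S 2 m)
    (hZL : MemLp Z 2 m) {y1 y2 y3 y4 s1 s2 z1 z2 : ℝ} (c : ℝ)
    (hy1 : ∫ ω, Y ω ∂m = y1) (hy2 : ∫ ω, Y ω ^ 2 ∂m = y2) (hy3 : ∫ ω, Y ω ^ 3 ∂m = y3)
    (hy4 : ∫ ω, Y ω ^ 4 ∂m = y4) (hs1 : ∫ ω, S ω ∂m = s1) (hs2 : ∫ ω, S ω ^ 2 ∂m = s2)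
    (hz1 : ∫ ω, Z ω ∂m = z1) (hz2 : ∫ ω, Z ω ^ 2 ∂m = z2) :
    MemLp (fun ω => Y ω * (c * (Y ω + S ω))) 2 m ∧
    MemLp (fun ω => Z ω * (c * (Y ω + S ω))) 2 m ∧
    ∫ ω, Y ω * (c * (Y ω + S ω)) ∂m = c * (y2 + y1 * s1) ∧
    ∫ ω, Z ω * (c * (Y ω + S ω)) ∂m = c * (z1 * (y1 + s1)) ∧
    cov[fun ω => Y ω * (c * (Y ω + S ω)), fun ω => Y ω * (c * (Y ω + S ω)); m]
      = c ^ 2 * (y4 + 2 * y3 * s1 + y2 * s2 - (y2 + y1 * s1) ^ 2) ∧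
    cov[fun ω => Z ω * (c * (Y ω + S ω)), fun ω => Z ω * (c * (Y ω + S ω)); m]
      = c ^ 2 * (z2 * (y2 + 2 * y1 * s1 + s2) - z1 ^ 2 * (y1 + s1) ^ 2) ∧
    cov[fun ω => Y ω * (c * (Y ω + S ω)), fun ω => Z ω * (c * (Y ω + S ω)); m]
      = c ^ 2 * z1 * (y3 + 2 * y2 * s1 + y1 * s2 - (y2 + y1 * s1) * (y1 + s1)) := by
  have pY : ∀ a ≤ 4, Integrable (fun ω => Y ω ^ a) m := fun a ha =>
    integrable_pow_of_memLp (by exact_mod_cast hYL) ha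
  have pS : ∀ a ≤ 2, Integrable (fun ω => S ω ^ a) m := fun a ha =>
    integrable_pow_of_memLp (by exact_mod_cast hSL) ha
  have pZ : ∀ a ≤ 2, Integrable (fun ω => Z ω ^ a) m := fun a ha =>
    integrable_pow_of_memLp (by exact_mod_cast hZL) ha
  have M := fun (a b e : ℕ) (ha : a ≤ 4) (hb : b ≤ 2) (he : e ≤ 2) =>
    integrable_monomial hYS hZ a b e (pY a ha) (pS b hb) (pZ e he)
  -- The digits are the exponents of `Y`, `S`, `Z`; these monomials are the ones that occur in the
  -- two products, their squares and their mixed product.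
  have m200 := M 2 0 0 (by simp) (by simp) (by simp)
  have m110 := M 1 1 0 (by simp) (by simp) (by simp)
  have m101 := M 1 0 1 (by simp) (by simp) (by simp)
  have m011 := M 0 1 1 (by simp) (by simp) (by simp)
  have m400 := M 4 0 0 (by simp) (by simp) (by simp)
  have m310 := M 3 1 0 (by simp) (by simp) (by simp)
  have m220 := M 2 2 0 (by simp) (by simp) (by simp)
  have m202 := M 2 0 2 (by simp) (by simp) (by simp)
  have m112 := M 1 1 2 (by simp) (by simp) (by simp)
  have m022 := M 0 2 2 (by simp) (by simp) (by simp)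
  have m301 := M 3 0 1 (by simp) (by simp) (by simp)
  have m211 := M 2 1 1 (by simp) (by simp) (by simp)
  have m121 := M 1 2 1 (by simp) (by simp) (by simp)
  clear M pY pS pZ
  simp only [pow_zero, pow_one, mul_one, one_mul, integral_const, probReal_univ, smul_eq_mul,
    hy1, hy2, hy3, hy4, hs1, hs2, hz1, hz2]
    at m200 m110 m101 m011 m400 m310 m220 m202 m112 m022 m301 m211 m121
  have eA : (fun ω => Y ω * (c * (Y ω + S ω))) = fun ω => c * (Y ω ^ 2 + Y ω * S ω) := by
    ext ω; ring
  have eB : (fun ω => Z ω * (c * (Y ω + S ω))) = fun ω => c * (Y ω * Z ω + S ω * Z ω) := by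
    ext ω; ring
  have iA : ∫ ω, Y ω * (c * (Y ω + S ω)) ∂m = c * (y2 + y1 * s1) := by
    rw [eA, integral_const_mul, integral_add m200.1 m110.1, m110.2, hy2]
  have iB : ∫ ω, Z ω * (c * (Y ω + S ω)) ∂m = c * (z1 * (y1 + s1)) := by
    rw [eB, integral_const_mul, integral_add m101.1 m011.1, m101.2, m011.2]; ring
  have AA : (fun ω => (Y ω * (c * (Y ω + S ω))) * (Y ω * (c * (Y ω + S ω)))) =
      fun ω => c ^ 2 * (Y ω ^ 4 + 2 * (Y ω ^ 3 * S ω) + Y ω ^ 2 * S ω ^ 2) := by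
    ext ω; ring
  have BB : (fun ω => (Z ω * (c * (Y ω + S ω))) * (Z ω * (c * (Y ω + S ω)))) =
      fun ω => c ^ 2 * (Y ω ^ 2 * Z ω ^ 2 + 2 * (Y ω * S ω * Z ω ^ 2) + S ω ^ 2 * Z ω ^ 2) := by
    ext ω; ring
  have AB : (fun ω => (Y ω * (c * (Y ω + S ω))) * (Z ω * (c * (Y ω + S ω)))) =
      fun ω => c ^ 2 * (Y ω ^ 3 * Z ω + 2 * (Y ω ^ 2 * S ω * Z ω) + Y ω * S ω ^ 2 * Z ω) := by
    ext ω; ring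
  have jA := (m200.1.add m110.1).const_mul c
  have jB := (m101.1.add m011.1).const_mul c
  have LA : MemLp (fun ω => Y ω * (c * (Y ω + S ω))) 2 m := by
    rw [memLp_two_iff_integrable_sq (by rw [eA]; exact jA.aestronglyMeasurable)]
    simp only [sq]
    rw [AA]
    exact ((m400.1.fun_add (m310.1.const_mul 2)).add m220.1).const_mul _
  have LB : MemLp (fun ω => Z ω * (c * (Y ω + S ω))) 2 m := by
    rw [memLp_two_iff_integrable_sq (by rw [eB]; exact jB.aestronglyMeasurable)]
    simp only [sq]
    rw [BB]
    exact ((m202.1.fun_add (m112.1.const_mul 2)).add m022.1).const_mul _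
  refine ⟨LA, LB, iA, iB, ?_, ?_, ?_⟩
  · rw [covariance_eq_sub LA LA, iA]
    simp only [Pi.mul_def]
    rw [AA, integral_const_mul, integral_add (m400.1.fun_add (m310.1.const_mul 2)) m220.1,
      integral_add m400.1 (m310.1.const_mul 2), integral_const_mul, m310.2, m220.2, hy4]
    ring
  · rw [covariance_eq_sub LB LB, iB]
    simp only [Pi.mul_def]
    rw [BB, integral_const_mul, integral_add (m202.1.fun_add (m112.1.const_mul 2)) m022.1,
      integral_add m202.1 (m112.1.const_mul 2), integral_const_mul, m202.2, m112.2, m022.2]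
    ring
  · rw [covariance_eq_sub LA LB, iA, iB]
    simp only [Pi.mul_def]
    rw [AB, integral_const_mul, integral_add (m301.1.fun_add (m211.1.const_mul 2)) m121.1,
      integral_add m301.1 (m211.1.const_mul 2), integral_const_mul, m301.2, m211.2, m121.2]
    ring

end Moments

/-! ### Raw moments and Pearson's inequality -/

section Parameters

variable {ν : Measure ℝ} [IsProbabilityMeasure ν] {μ σ γ κ : ℝ}

/-- The raw moments in terms of the mean, standard deviation, skewness and kurtosis, together with
Pearson's inequality. -/
theorem raw_moments (hν : MemLp id 4 ν) (hμ : μ = ∫ x, x ∂ν) (hσ : 0 < σ)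
    (hσν : σ ^ 2 = Var[id; ν]) (hγ : γ = skewness ν) (hκ : κ = kurtosis ν) :
    ∫ x, x ^ 2 ∂ν = μ ^ 2 + σ ^ 2 ∧
    ∫ x, x ^ 3 ∂ν = μ ^ 3 + 3 * μ * σ ^ 2 + γ * σ ^ 3 ∧
    ∫ x, x ^ 4 ∂ν = μ ^ 4 + 6 * μ ^ 2 * σ ^ 2 + 4 * μ * γ * σ ^ 3 + κ * σ ^ 4 ∧
    γ ^ 2 + 1 ≤ κ := by
  have hc : MemLp (fun x : ℝ => x - μ) 4 ν := hν.sub (memLp_const μ)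
  have pc : ∀ a ≤ 4, Integrable (fun x : ℝ => (x - μ) ^ a) ν := fun a ha =>
    integrable_pow_of_memLp (by exact_mod_cast hc) ha
  have p1 : Integrable (fun x : ℝ => x - μ) ν := by simpa using pc 1 (by simp)
  have c1 : ∫ x, (x - μ) ∂ν = 0 := by
    have hi : Integrable (fun x : ℝ => x) ν := hν.integrable (by norm_num)
    rw [integral_sub hi (by simp), ← hμ]
    simp
  have c2 : ∫ x, (x - μ) ^ 2 ∂ν = σ ^ 2 := by
    rw [hσν, variance_eq_integral aemeasurable_id, hμ]
    rfl
  have hs : Real.sqrt Var[id; ν] = σ := by rw [← hσν, Real.sqrt_sq hσ.le]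
  have c3 : ∫ x, (x - μ) ^ 3 ∂ν = γ * σ ^ 3 := by
    have : centralMoment id 3 ν = ∫ x, (x - μ) ^ 3 ∂ν := by rw [hμ]; rfl
    rw [hγ, skewness, hs, this, div_mul_cancel₀ _ (by positivity)]
  have c4 : ∫ x, (x - μ) ^ 4 ∂ν = κ * σ ^ 4 := by
    have : centralMoment id 4 ν = ∫ x, (x - μ) ^ 4 ∂ν := by rw [hμ]; rfl
    rw [hκ, kurtosis, ← hσν, this, ← pow_mul, div_mul_cancel₀ _ (by positivity)]
  -- Each claim below expands a quartic around `μ`; the coefficient `a1` drops out by centring.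
  have lin : ∀ a0 a1 a2 a3 a4 : ℝ, ∫ x, (a0 + a1 * (x - μ) + a2 * (x - μ) ^ 2
      + a3 * (x - μ) ^ 3 + a4 * (x - μ) ^ 4) ∂ν
      = a0 + a2 * σ ^ 2 + a3 * (γ * σ ^ 3) + a4 * (κ * σ ^ 4) := by
    intro a0 a1 a2 a3 a4
    have q1 := p1.const_mul a1
    have q2 := (pc 2 (by simp)).const_mul a2
    have q3 := (pc 3 (by simp)).const_mul a3
    have q4 := (pc 4 (by simp)).const_mul a4
    have q0 : Integrable (fun _ : ℝ => a0) ν := integrable_const _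
    rw [integral_add (((q0.fun_add q1).fun_add q2).fun_add q3) q4,
      integral_add ((q0.fun_add q1).fun_add q2) q3,
      integral_add (q0.fun_add q1) q2, integral_add q0 q1]
    simp only [integral_const_mul, c1, c2, c3, c4]
    simp
  refine ⟨?_, ?_, ?_, ?_⟩
  · rw [← (by ring : μ ^ 2 + 1 * σ ^ 2 + 0 * (γ * σ ^ 3) + 0 * (κ * σ ^ 4) = μ ^ 2 + σ ^ 2),
      ← lin (μ ^ 2) (2 * μ)]
    congr with x
    ring
  · rw [← (by ring : μ ^ 3 + 3 * μ * σ ^ 2 + 1 * (γ * σ ^ 3) + 0 * (κ * σ ^ 4)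
      = μ ^ 3 + 3 * μ * σ ^ 2 + γ * σ ^ 3), ← lin (μ ^ 3) (3 * μ ^ 2)]
    congr with x
    ring
  · rw [← (by ring : μ ^ 4 + 6 * μ ^ 2 * σ ^ 2 + 4 * μ * (γ * σ ^ 3) + 1 * (κ * σ ^ 4)
      = μ ^ 4 + 6 * μ ^ 2 * σ ^ 2 + 4 * μ * γ * σ ^ 3 + κ * σ ^ 4), ← lin (μ ^ 4) (4 * μ ^ 3)]
    congr with x
    ring
  -- The squared function is the residual of the least-squares regression of `(x - μ)²` on `1` and
  -- `x - μ`.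
  · have hp : 0 ≤ ∫ x, ((x - μ) ^ 2 - γ * σ * (x - μ) - σ ^ 2) ^ 2 ∂ν :=
      integral_nonneg fun x => sq_nonneg _
    have he : ∫ x, ((x - μ) ^ 2 - γ * σ * (x - μ) - σ ^ 2) ^ 2 ∂ν
        = σ ^ 4 * (κ - γ ^ 2 - 1) := by
      have := lin (σ ^ 4) (2 * γ * σ ^ 3) (γ ^ 2 * σ ^ 2 - 2 * σ ^ 2) (-2 * γ * σ) 1
      rw [show σ ^ 4 * (κ - γ ^ 2 - 1) = σ ^ 4 + (γ ^ 2 * σ ^ 2 - 2 * σ ^ 2) * σ ^ 2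
        + -2 * γ * σ * (γ * σ ^ 3) + 1 * (κ * σ ^ 4) by ring, ← this]
      congr with x
      ring
    rw [he] at hp
    have := nonneg_of_mul_nonneg_right hp (by positivity : 0 < σ ^ 4)
    linarith

end Parameters

/-! ### The error function and Gaussian tails -/

section ErrorFunction

theorem integrable_exp_neg_sq : Integrable fun t : ℝ => Real.exp (-t ^ 2) := by
  simpa using integrable_exp_neg_mul_sq one_pos

theorem erf_strictMono : StrictMono erf := by
  intro x y hxy
  have hi : ∀ a b : ℝ, IntervalIntegrable (fun t : ℝ => Real.exp (-t ^ 2)) volume a b :=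
    fun a b => integrable_exp_neg_sq.intervalIntegrable
  have hpos : 0 < ∫ t in x..y, Real.exp (-t ^ 2) :=
    intervalIntegral.intervalIntegral_pos_of_pos (hi x y) (fun t => Real.exp_pos _) hxy
  have hadd := intervalIntegral.integral_add_adjacent_intervals (hi 0 x) (hi x y)
  unfold erf
  have : 0 < 2 / Real.sqrt Real.pi := by positivity
  rw [← hadd]
  nlinarith

theorem erf_zero : erf 0 = 0 := by simp [erf]

theorem integral_Ioi_exp_neg_sq (b : ℝ) :
    ∫ t in Set.Ioi (-b), Real.exp (-t ^ 2) = Real.sqrt Real.pi / 2 * (1 + erf b) := by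
  have h1 := intervalIntegral.integral_interval_add_Ioi (f := fun t : ℝ => Real.exp (-t ^ 2))
    (μ := volume) (a := -b) (b := 0) integrable_exp_neg_sq.integrableOn
    integrable_exp_neg_sq.integrableOn
  have h2 : ∫ t in Set.Ioi (0 : ℝ), Real.exp (-t ^ 2) = Real.sqrt Real.pi / 2 := by
    simpa using integral_gaussian_Ioi 1
  have h3 : ∫ t in (-b)..0, Real.exp (-t ^ 2) = ∫ t in (0 : ℝ)..b, Real.exp (-t ^ 2) := by
    rw [← neg_zero, ← intervalIntegral.integral_comp_neg fun t : ℝ => Real.exp (-t ^ 2)]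
    simp_rw [neg_sq, neg_zero]
  rw [← h1, h2, h3, erf]
  have : Real.sqrt Real.pi ≠ 0 := by positivity
  field_simp
  ring

/-- Centre the Gaussian and substitute `y = x / √(2v)`, which turns its density into a multiple of
`exp(-y²)`. -/
theorem gaussianReal_Ioi_zero (a : ℝ) {v : NNReal} (hv : v ≠ 0) :
    (gaussianReal a v).real (Set.Ioi 0) = 1 / 2 * (1 + erf (a / Real.sqrt (2 * v))) := by
  have hv' : (0 : ℝ) < v := by positivity
  have hmap : gaussianReal a v = (gaussianReal 0 v).map (· + a) := by
    rw [gaussianReal_map_add_const, zero_add]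
  rw [hmap, map_measureReal_apply (by fun_prop) measurableSet_Ioi, Set.preimage_add_const_Ioi,
    measureReal_def, gaussianReal_apply_eq_integral _ hv,
    ENNReal.toReal_ofReal (integral_nonneg fun x => gaussianPDFReal_nonneg _ _ _)]
  set c := Real.sqrt (2 * v) with hc
  have hcpos : 0 < c := by positivity
  have hcsq : c ^ 2 = 2 * v := Real.sq_sqrt (by positivity)
  have hpdf : ∀ x, gaussianPDFReal 0 v x
      = (Real.sqrt Real.pi)⁻¹ * c⁻¹ * Real.exp (-(c⁻¹ * x) ^ 2) := by
    intro x
    have h1 : Real.sqrt (2 * Real.pi * v) = c * Real.sqrt Real.pi := by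
      rw [hc, ← Real.sqrt_mul (by positivity)]
      congr 1
      ring
    rw [gaussianPDFReal, h1, mul_inv, mul_comm c⁻¹]
    congr 2
    rw [mul_pow, inv_pow, hcsq]
    ring
  simp_rw [hpdf]
  rw [integral_const_mul,
    integral_comp_mul_left_Ioi (fun y => Real.exp (-y ^ 2)) _ (inv_pos.2 hcpos), zero_sub,
    show c⁻¹ * -a = -(a / c) by ring, integral_Ioi_exp_neg_sq, smul_eq_mul, inv_inv]
  have : Real.sqrt Real.pi ≠ 0 := by positivity
  field_simp

end ErrorFunction

/-! ### The bivariate normal approximation -/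

section NormalApproximation

variable {Ω : Type*} [MeasurableSpace Ω] {P : Measure Ω}

/-- The quadratic form at `x` is the variance of `x 0 * S + x 1 * T`. -/
theorem posSemidef_covariance [IsFiniteMeasure P] {S T : Ω → ℝ} (hS : MemLp S 2 P)
    (hT : MemLp T 2 P) :
    (!![Var[S; P], cov[S, T; P]; cov[S, T; P], Var[T; P]]).PosSemidef := by
  refine Matrix.PosSemidef.of_dotProduct_mulVec_nonneg ?_ fun x => ?_
  · ext i j
    fin_cases i <;> fin_cases j <;> simp
  · have h := variance_nonneg (fun ω => x 0 * S ω + x 1 * T ω) P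
    rw [variance_fun_add (hS.const_mul _) (hT.const_mul _), variance_const_mul,
      variance_const_mul, covariance_const_mul_left, covariance_const_mul_right] at h
    refine h.trans_eq ?_
    simp [Matrix.mulVec, dotProduct, Fin.sum_univ_two]
    ring

/-- A continuous linear functional of a Gaussian vector is Gaussian, hence determined by its mean
and variance. -/
theorem map_sub_multivariateGaussian (a : EuclideanSpace ℝ (Fin 2)) {M : Matrix (Fin 2) (Fin 2) ℝ}
    (hM : M.PosSemidef) :
    (multivariateGaussian a M).map (fun x => x 0 - x 1)
      = gaussianReal (a 0 - a 1) (M 0 0 - 2 * M 0 1 + M 1 1).toNNReal := by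
  let L : StrongDual ℝ (EuclideanSpace ℝ (Fin 2)) :=
    EuclideanSpace.proj 0 - EuclideanSpace.proj 1
  have hL : (fun x : EuclideanSpace ℝ (Fin 2) => x 0 - x 1) = L := by
    ext x
    simp [L]
  have hmem : ∀ i, MemLp (fun x : EuclideanSpace ℝ (Fin 2) => x i) 2 (multivariateGaussian a M) :=
    fun i => IsGaussian.memLp_dual _
      (EuclideanSpace.proj i : StrongDual ℝ (EuclideanSpace ℝ (Fin 2))) 2 (by simp)
  rw [hL, IsGaussian.map_eq_gaussianReal, ContinuousLinearMap.integral_comp_id_comm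
    IsGaussian.integrable_id, integral_id_multivariateGaussian, ← hL,
    variance_fun_sub (hmem 0) (hmem 1), variance_eval_multivariateGaussian hM,
    variance_eval_multivariateGaussian hM, covariance_eval_multivariateGaussian hM]

theorem approxProbGT_eq [IsFiniteMeasure P] {S T : Ω → ℝ} (hS : MemLp S 2 P) (hT : MemLp T 2 P)
    (hv : 0 < Var[S; P] - 2 * cov[S, T; P] + Var[T; P]) :
    approxProbGT P S T = 1 / 2 * (1 + erf ((∫ ω, S ω ∂P - ∫ ω, T ω ∂P)
      / Real.sqrt (2 * (Var[S; P] - 2 * cov[S, T; P] + Var[T; P])))) := by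
  have hset : {x : EuclideanSpace ℝ (Fin 2) | x 1 < x 0} = (fun x => x 0 - x 1) ⁻¹' Set.Ioi 0 := by
    ext x
    simp
  rw [approxProbGT, hset, normalApprox,
    ← map_measureReal_apply (by fun_prop) measurableSet_Ioi,
    map_sub_multivariateGaussian _ (posSemidef_covariance hS hT), gaussianReal_Ioi_zero]
  · simp [Real.coe_toNNReal _ hv.le]
  · simpa using hv

end NormalApproximation

/-! ### Bivariate central limit theorem -/

section JointCLT

open scoped RealInnerProductSpace

/-- Bivariate central limit theorem for a triangular array with identically distributed
independent rows, up to the choice of the probability spaces. -/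
theorem tendstoInDistribution_pair {E : Type*} [MeasurableSpace E] {m : Measure E}
    [IsProbabilityMeasure m] {Ω : ℕ → Type*} [∀ d, MeasurableSpace (Ω d)]
    {P : ∀ d, Measure (Ω d)} [∀ d, IsProbabilityMeasure (P d)]
    {ξ : ∀ d, Fin d → Ω d → E} (h : ∀ d, iIndepFun (ξ d) (P d))
    (hl : ∀ d j, HasLaw (ξ d j) m (P d)) {f g : E → ℝ} (hf : MemLp f 2 m) (hg : MemLp g 2 m)
    (hfm : Measurable f) (hgm : Measurable g) :
    TendstoInDistribution
      (fun (d : ℕ) ω => (Real.sqrt d)⁻¹ • !₂[∑ j, f (ξ d j ω) - d * ∫ x, f x ∂m,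
        ∑ j, g (ξ d j ω) - d * ∫ x, g x ∂m])
      atTop (id : EuclideanSpace ℝ (Fin 2) → EuclideanSpace ℝ (Fin 2)) P
      (multivariateGaussian 0 !![Var[f; m], cov[f, g; m]; cov[f, g; m], Var[g; m]]) := by
  have hsum : ∀ {f : E → ℝ}, Measurable f → ∀ d,
      AEMeasurable (fun ω => ∑ j, f (ξ d j ω)) (P d) := fun {f} hfm d =>
    Finset.aemeasurable_fun_sum _ fun j _ => hfm.comp_aemeasurable (hl d j).aemeasurable
  have hmeas : ∀ d : ℕ, AEMeasurable (fun ω => (Real.sqrt d)⁻¹ •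
      !₂[∑ j, f (ξ d j ω) - d * ∫ x, f x ∂m, ∑ j, g (ξ d j ω) - d * ∫ x, g x ∂m]) (P d) := by
    intro d
    have hc : Measurable fun x : EuclideanSpace ℝ (Fin 2) => (Real.sqrt d)⁻¹ • x := by fun_prop
    refine hc.comp_aemeasurable ?_
    refine (PiLp.continuous_toLp 2 _).measurable.comp_aemeasurable
      (aemeasurable_pi_lambda _ fun i => ?_)
    fin_cases i
    · exact (hsum hfm d).sub_const _
    · exact (hsum hgm d).sub_const _
  refine ⟨hmeas, aemeasurable_id, ?_⟩
  refine ProbabilityMeasure.tendsto_iff_tendsto_charFun.2 fun t => ?_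
  have hfi := hf.integrable one_le_two
  have hgi := hg.integrable one_le_two
  -- Cramér–Wold: pairing with `t` leaves a scaled i.i.d. sum of the centred function `q`, whose
  -- variance is the quadratic form of the limiting covariance matrix at `t`.
  set q : E → ℝ := fun x => t 0 * (f x - ∫ y, f y ∂m) + t 1 * (g x - ∫ y, g y ∂m) with hq
  have hqm : Measurable q := by fun_prop
  have cf : MemLp (fun x => f x - ∫ y, f y ∂m) 2 m := hf.sub (memLp_const _)
  have cg : MemLp (fun x => g x - ∫ y, g y ∂m) 2 m := hg.sub (memLp_const _)
  have hqL : MemLp q 2 m := (cf.const_mul _).add (cg.const_mul _)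
  have hq0 : ∫ x, q x ∂m = 0 := by
    rw [hq, integral_add ((cf.integrable one_le_two).const_mul _)
      ((cg.integrable one_le_two).const_mul _), integral_const_mul, integral_const_mul,
      integral_sub hfi (integrable_const _), integral_sub hgi (integrable_const _)]
    simp
  have hqv : Var[q; m] = t 0 ^ 2 * Var[f; m] + 2 * (t 0 * t 1 * cov[f, g; m])
      + t 1 ^ 2 * Var[g; m] := by
    rw [hq, variance_fun_add (cf.const_mul _) (cg.const_mul _), variance_const_mul,
      variance_const_mul, covariance_const_mul_left, covariance_const_mul_right,
      variance_sub_const hf.aestronglyMeasurable, variance_sub_const hg.aestronglyMeasurable,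
      covariance_sub_const_left hfi, covariance_sub_const_right hgi]
    ring
  have hchar : ∀ d : ℕ, charFun ((P d).map fun ω => (Real.sqrt d)⁻¹ •
      !₂[∑ j, f (ξ d j ω) - d * ∫ x, f x ∂m, ∑ j, g (ξ d j ω) - d * ∫ x, g x ∂m]) t
      = charFun (m.map q) (Real.sqrt d)⁻¹ ^ d := by
    intro d
    have e1 : ∀ ω, ⟪(Real.sqrt d)⁻¹ • !₂[∑ j, f (ξ d j ω) - d * ∫ x, f x ∂m,
        ∑ j, g (ξ d j ω) - d * ∫ x, g x ∂m], t⟫ = (Real.sqrt d)⁻¹ * ∑ j, q (ξ d j ω) := by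
      intro ω
      rw [real_inner_smul_left]
      simp only [hq, PiLp.inner_apply, Fin.sum_univ_two, Finset.sum_add_distrib,
        ← Finset.mul_sum, Finset.sum_sub_distrib]
      simp
    have e2 := charFun_map_mul_comp (hsum hqm d) (Real.sqrt d)⁻¹ 1
    rw [mul_one] at e2
    rw [← charFun_map_sum_comp (h d) (hl d) hqm, ← e2, charFun_apply, charFun_apply,
      integral_map (hmeas d) (by fun_prop), integral_map ((hsum hqm d).const_mul _) (by fun_prop)]
    simp [e1]
  have hlim : charFun ((multivariateGaussian (0 : EuclideanSpace ℝ (Fin 2))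
      !![Var[f; m], cov[f, g; m]; cov[f, g; m], Var[g; m]]).map id) t
      = Complex.exp (-(Var[q; m] : ℝ) / 2) := by
    rw [Measure.map_id, charFun_multivariateGaussian (posSemidef_covariance hf hg), hqv]
    congr 1
    simp [Matrix.mulVec, dotProduct, Fin.sum_univ_two]
    ring
  have := tendsto_charFun_inv_sqrt_pow hqL hq0
  simp only [← hchar, ← hlim] at this
  exact this

end JointCLT

/-! ### Moments of one column -/

section Column

variable {N k : ℕ} {U : Finset (Fin N)} {iin iout : Fin N} {ν : Measure ℝ}
  [IsProbabilityMeasure ν] {μ σ γ κ : ℝ}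

/-- The contribution of one coordinate to the similarity with the center. -/
noncomputable def coordSim (U : Finset (Fin N)) (i : Fin N) (x : Fin N → ℝ) : ℝ :=
  x i * ((U.card : ℝ)⁻¹ * ∑ l ∈ U, x l)

theorem measurable_coordSim (U : Finset (Fin N)) (i : Fin N) : Measurable (coordSim U i) := by
  unfold coordSim
  fun_prop

theorem simToCenter_eq_sum {d : ℕ} {Ω : Type*} (X : Fin N → Ω → EuclideanSpace ℝ (Fin d))
    (U : Finset (Fin N)) (i : Fin N) (ω : Ω) :
    simToCenter X U i ω = ∑ j, coordSim U i fun l => X l ω j := by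
  simp [simToCenter, similarity, center, coordSim]

theorem coordSim_moments (hk : 2 ≤ k) (hU : U.card = k) (hin : iin ∈ U) (hout : iout ∉ U)
    (hν : MemLp id 4 ν) (hμ : μ = ∫ x, x ∂ν) (hσ : 0 < σ) (hσν : σ ^ 2 = Var[id; ν])
    (hγ : γ = skewness ν) (hκ : κ = kurtosis ν) :
    MemLp (coordSim U iin) 2 (Measure.pi fun _ => ν) ∧
    MemLp (coordSim U iout) 2 (Measure.pi fun _ => ν) ∧
    ∫ x, coordSim U iin x ∂(Measure.pi fun _ => ν) = μ ^ 2 + σ ^ 2 / k ∧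
    Var[coordSim U iin; Measure.pi fun _ => ν] =
      (k * (k + 3) * μ ^ 2 * σ ^ 2 + 2 * (k + 1) * μ * γ * σ ^ 3
        + (κ + k - 2) * σ ^ 4) / k ^ 2 ∧
    ∫ x, coordSim U iout x ∂(Measure.pi fun _ => ν) = μ ^ 2 ∧
    Var[coordSim U iout; Measure.pi fun _ => ν] = (σ ^ 4 + (k + 1) * σ ^ 2 * μ ^ 2) / k ∧
    cov[coordSim U iin, coordSim U iout; Measure.pi fun _ => ν] =
      (2 * k * μ ^ 2 * σ ^ 2 + μ * γ * σ ^ 3) / k ^ 2 := by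
  set m : Measure (Fin N → ℝ) := Measure.pi fun _ => ν
  obtain ⟨r2, r3, r4, -⟩ := raw_moments hν hμ hσ hσν hγ hκ
  have hk0 : (k : ℝ) ≠ 0 := by positivity
  have hind : iIndepFun (fun i (x : Fin N → ℝ) => x i) m :=
    iIndepFun_pi (X := fun _ => id) fun _ => aemeasurable_id
  have hlaw : ∀ i, HasLaw (fun x : Fin N → ℝ => x i) ν m := fun i =>
    (measurePreserving_eval (fun _ : Fin N => ν) i).hasLaw
  have hL4 : ∀ i, MemLp (fun x : Fin N → ℝ => x i) 4 m := fun i =>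
    hν.comp_measurePreserving (measurePreserving_eval (fun _ : Fin N => ν) i)
  have hL2 : ∀ i, MemLp (fun x : Fin N → ℝ => x i) 2 m := fun i =>
    (hL4 i).mono_exponent (by norm_num)
  have hpow : ∀ (i : Fin N) (a : ℕ), ∫ x, x i ^ a ∂m = ∫ y, y ^ a ∂ν := fun i a =>
    (hlaw i).integral_comp (f := fun y : ℝ => y ^ a) (by fun_prop)
  have h1 : ∀ i : Fin N, ∫ x, x i ∂m = μ := fun i => by rw [(hlaw i).integral_eq, hμ]
  have hVar : ∀ i : Fin N, Var[fun x => x i; m] = σ ^ 2 := fun i => by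
    rw [(hlaw i).variance_eq, hσν]
  set S : (Fin N → ℝ) → ℝ := fun x => ∑ l ∈ U.erase iin, x l with hS
  have hcard : ((U.erase iin).card : ℝ) = k - 1 := by
    rw [Finset.card_erase_of_mem hin, hU, Nat.cast_sub (by omega), Nat.cast_one]
  have hSL : MemLp S 2 m := memLp_finsetSum _ fun i _ => hL2 i
  have s1 : ∫ x, S x ∂m = (k - 1) * μ := by
    rw [hS, integral_finsetSum _ fun i _ => (hL2 i).integrable one_le_two]
    simp [h1, hcard]
  have sv : Var[S; m] = (k - 1) * σ ^ 2 := by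
    have := IndepFun.variance_sum (X := fun i (x : Fin N → ℝ) => x i) (s := U.erase iin) (μ := m)
      (fun i _ => hL2 i) fun i _ j _ hij => hind.indepFun hij
    simp only [hVar, Finset.sum_const, nsmul_eq_mul, hcard] at this
    rw [← this]
    congr 1
    ext x
    simp [hS]
  have s2 : ∫ x, S x ^ 2 ∂m = (k - 1) * σ ^ 2 + ((k - 1) * μ) ^ 2 := by
    have := variance_eq_sub hSL
    rw [sv, s1] at this
    simp only [Pi.pow_apply] at this
    linarith
  -- The blocks `U` and `{iout}` are disjoint, and `S` is a function of the first: its total minus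
  -- `x iin`.
  have hUout : IndepFun (fun x : Fin N → ℝ => (x iin, S x)) (fun x => x iout) m := by
    have hI := hind.indepFun_finset U {iout} (by simpa using hout) fun i => measurable_pi_apply i
    have hψ : Measurable fun y : ({iout} : Finset (Fin N)) → ℝ => y ⟨iout, by simp⟩ :=
      measurable_pi_apply _
    have hI' := hI.comp (φ := fun y : U → ℝ => (y ⟨iin, hin⟩, ∑ l, y l - y ⟨iin, hin⟩))
      (by fun_prop) hψ
    have hfst : (fun x : Fin N → ℝ => (x iin, S x)) =
        fun x => (x iin, ∑ l : U, x l - x iin) := by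
      ext x
      · rfl
      · simp only [hS]
        rw [Finset.sum_erase_eq_sub hin, Finset.sum_coe_sort U x]
    rw [hfst]
    exact hI'
  have hinS : IndepFun (fun x : Fin N → ℝ => x iin) S m := by
    have := hind.indepFun_finsetSum_of_notMem (fun i => measurable_pi_apply i)
      (Finset.notMem_erase iin U)
    convert this.symm using 1
    ext x
    simp [hS]
  obtain ⟨LA, LB, iA, iB, vA, vB, cAB⟩ := moments_of_indep hinS hUout (hL4 iin) hSL (hL2 iout)
    (k : ℝ)⁻¹ (h1 iin) ((hpow iin 2).trans r2) ((hpow iin 3).trans r3) ((hpow iin 4).trans r4)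
    s1 s2 (h1 iout) ((hpow iout 2).trans r2)
  have eS : ∀ i, coordSim U i = fun x => x i * ((k : ℝ)⁻¹ * (x iin + S x)) := by
    intro i
    ext x
    rw [coordSim, hU, hS, Finset.add_sum_erase U x hin]
  rw [← eS] at LA LB iA iB vA vB cAB
  simp only [← eS] at cAB
  have iA' : ∫ x, coordSim U iin x ∂m = μ ^ 2 + σ ^ 2 / k := by
    rw [iA]
    field_simp
    ring
  have iB' : ∫ x, coordSim U iout x ∂m = μ ^ 2 := by
    rw [iB]
    field_simp
    ring
  rw [covariance_self (measurable_coordSim _ _).aemeasurable] at vA vB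
  refine ⟨LA, LB, iA', ?_, iB', ?_, ?_⟩
  · rw [vA]
    field_simp
    ring
  · rw [vB]
    field_simp
    ring
  · rw [cAB]
    field_simp
    ring

end Column

/-! ### Columns of the embeddings and marginal limit laws -/

theorem IsIIDEmbedding.hasLaw_transpose {N d : ℕ} {Ω : Type*} [MeasurableSpace Ω] {P : Measure Ω}
    {ν : Measure ℝ} [IsProbabilityMeasure ν] {X : Fin N → Ω → EuclideanSpace ℝ (Fin d)}
    (hX : IsIIDEmbedding P ν X) :
    HasLaw (fun ω j l => X l ω j) (Measure.pi fun _ : Fin d => Measure.pi fun _ : Fin N => ν) P :=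
  AvgEmbedding.hasLaw_transpose (Y := fun l ω => (X l ω).ofLp)
    (hX.indep.comp (fun _ => WithLp.ofLp) fun _ => by fun_prop) hX.indep_entries hX.law_entries

theorem IsIIDEmbedding.hasLaw_column {N d : ℕ} {Ω : Type*} [MeasurableSpace Ω] {P : Measure Ω}
    {ν : Measure ℝ} [IsProbabilityMeasure ν] {X : Fin N → Ω → EuclideanSpace ℝ (Fin d)}
    (hX : IsIIDEmbedding P ν X) (j : Fin d) :
    HasLaw (fun ω l => X l ω j) (Measure.pi fun _ : Fin N => ν) P :=
  (measurePreserving_eval (fun _ : Fin d => Measure.pi fun _ : Fin N => ν) j).fun_comp_hasLaw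
    hX.hasLaw_transpose

theorem IsIIDEmbedding.iIndepFun_column {N d : ℕ} {Ω : Type*} [MeasurableSpace Ω] {P : Measure Ω}
    [IsProbabilityMeasure P]
    {ν : Measure ℝ} [IsProbabilityMeasure ν] {X : Fin N → Ω → EuclideanSpace ℝ (Fin d)}
    (hX : IsIIDEmbedding P ν X) : iIndepFun (fun j ω l => X l ω j) P := by
  rw [iIndepFun_iff_map_fun_eq_pi_map fun j => (hX.hasLaw_column j).aemeasurable,
    hX.hasLaw_transpose.map_eq]
  congr with j : 1
  exact (hX.hasLaw_column j).map_eq.symm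

theorem _root_.MeasureTheory.TendstoInDistribution.of_hasLaw {E ι Ω' : Type*} [TopologicalSpace E]
    [MeasurableSpace E] [OpensMeasurableSpace E] {Ω : ι → Type*} [∀ i, MeasurableSpace (Ω i)]
    {P : ∀ i, Measure (Ω i)} [∀ i, IsProbabilityMeasure (P i)] [MeasurableSpace Ω']
    {Q : Measure Ω'} [IsProbabilityMeasure Q] {ρ : Measure E} [IsProbabilityMeasure ρ]
    {Y : ∀ i, Ω i → E} {Z : Ω' → E} {l : Filter ι} (h : TendstoInDistribution Y l Z P Q)
    (hZ : HasLaw Z ρ Q) : TendstoInDistribution Y l id P ρ := by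
  refine ⟨h.forall_aemeasurable, aemeasurable_id, ?_⟩
  convert! h.tendsto using 2
  simp [hZ.map_eq]

theorem hasLaw_eval_div_sqrt {M : Matrix (Fin 2) (Fin 2) ℝ} (hM : M.PosSemidef) (i : Fin 2)
    (hi : 0 < M i i) :
    HasLaw (fun x : EuclideanSpace ℝ (Fin 2) => x i / Real.sqrt (M i i)) (gaussianReal 0 1)
      (multivariateGaussian 0 M) := by
  have h := gaussianReal_div_const
    (measurePreserving_eval_multivariateGaussian (μ := 0) hM (i := i)).hasLaw (Real.sqrt (M i i))
  convert h using 2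
  · simp
  · ext
    simp [Real.sq_sqrt hi.le, hi.le, hi.ne']

theorem div_sqrt_eq_sqrt {a b : ℝ} (ha : 0 ≤ a) : a / Real.sqrt b = Real.sqrt (a ^ 2 / b) := by
  rw [Real.sqrt_div (sq_nonneg a), Real.sqrt_sq ha]

end AvgEmbedding

/-! ### The main theorem -/

theorem proposition1 (N k : ℕ) (hk : 2 ≤ k)
    (U : Finset (Fin N)) (hU : U.card = k)
    (iin : Fin N) (hin : iin ∈ U) (iout : Fin N) (hout : iout ∉ U)
    -- the common distribution of the entries, with finite fourth moment, and its parameters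
    (ν : Measure ℝ) [IsProbabilityMeasure ν] (hν : MemLp id 4 ν)
    (μ σ γ κ : ℝ) (hμ : μ = ∫ x, x ∂ν) (hσ : 0 < σ) (hσν : σ ^ 2 = Var[id; ν])
    (hγ : γ = AvgEmbedding.skewness ν) (hκ : κ = AvgEmbedding.kurtosis ν)
    -- for every dimension `d`, i.i.d. embeddings in `ℝ^d` with i.i.d. entries
    (Ω : ℕ → Type*) [∀ d, MeasurableSpace (Ω d)] (P : ∀ d, Measure (Ω d))
    [∀ d, IsProbabilityMeasure (P d)]
    (X : ∀ d, Fin N → Ω d → EuclideanSpace ℝ (Fin d))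
    (hX : ∀ d, AvgEmbedding.IsIIDEmbedding (P d) ν (X d))
    -- the two similarities
    (sIn sOut : ∀ d, Ω d → ℝ)
    (hsIn : ∀ d, sIn d = AvgEmbedding.simToCenter (X d) U iin)
    (hsOut : ∀ d, sOut d = AvgEmbedding.simToCenter (X d) U iout) :
    -- means, variances and covariance
    (∀ d, MemLp (sIn d) 2 (P d) ∧ MemLp (sOut d) 2 (P d) ∧
      ∫ ω, sIn d ω ∂(P d) = d * (μ ^ 2 + σ ^ 2 / k) ∧
      Var[sIn d; P d] = d * (k * (k + 3) * μ ^ 2 * σ ^ 2 + 2 * (k + 1) * μ * γ * σ ^ 3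
        + (κ + k - 2) * σ ^ 4) / k ^ 2 ∧
      ∫ ω, sOut d ω ∂(P d) = d * μ ^ 2 ∧
      Var[sOut d; P d] = d * (σ ^ 4 + (k + 1) * σ ^ 2 * μ ^ 2) / k ∧
      cov[sIn d, sOut d; P d] = d * (2 * k * μ ^ 2 * σ ^ 2 + μ * γ * σ ^ 3) / k ^ 2) ∧
    (∀ d, 1 ≤ d → 0 < Var[sIn d; P d] ∧ 0 < Var[sOut d; P d]) ∧
    -- asymptotic normality of each of the two similarities
    TendstoInDistribution
      (fun d ω => (sIn d ω - ∫ ω', sIn d ω' ∂(P d)) / Real.sqrt Var[sIn d; P d])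
      atTop (id : ℝ → ℝ) P (gaussianReal 0 1) ∧
    TendstoInDistribution
      (fun d ω => (sOut d ω - ∫ ω', sOut d ω' ∂(P d)) / Real.sqrt Var[sOut d; P d])
      atTop (id : ℝ → ℝ) P (gaussianReal 0 1) ∧
    -- joint asymptotic normality
    TendstoInDistribution
      (fun (d : ℕ) ω => (Real.sqrt d)⁻¹ • !₂[sIn d ω - ∫ ω', sIn d ω' ∂(P d),
        sOut d ω - ∫ ω', sOut d ω' ∂(P d)])
      atTop (id : EuclideanSpace ℝ (Fin 2) → EuclideanSpace ℝ (Fin 2)) P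
      (multivariateGaussian 0
        !![(k * (k + 3) * μ ^ 2 * σ ^ 2 + 2 * (k + 1) * μ * γ * σ ^ 3
              + (κ + k - 2) * σ ^ 4) / k ^ 2,
           (2 * k * μ ^ 2 * σ ^ 2 + μ * γ * σ ^ 3) / k ^ 2;
           (2 * k * μ ^ 2 * σ ^ 2 + μ * γ * σ ^ 3) / k ^ 2,
           (σ ^ 4 + (k + 1) * σ ^ 2 * μ ^ 2) / k]) ∧
    -- the probability under the normal approximation; it exceeds `1 / 2` and increases with `d`
    (∀ d : ℕ, 1 ≤ d →
      0 < d * σ ^ 2 / (2 * ((2 * (k - 1) + κ) * σ ^ 2 + 2 * k * γ * μ * σ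
        + 2 * k ^ 2 * μ ^ 2)) ∧
      AvgEmbedding.approxProbGT (P d) (sIn d) (sOut d) =
        1 / 2 * (1 + AvgEmbedding.erf (Real.sqrt
          (d * σ ^ 2 / (2 * ((2 * (k - 1) + κ) * σ ^ 2 + 2 * k * γ * μ * σ
            + 2 * k ^ 2 * μ ^ 2))))) ∧
      1 / 2 < AvgEmbedding.approxProbGT (P d) (sIn d) (sOut d)) ∧
    StrictMonoOn (fun d : ℕ => AvgEmbedding.approxProbGT (P d) (sIn d) (sOut d))
      (Set.Ici 1) := by
  obtain ⟨LA, LB, iA, vA, iB, vB, cAB⟩ :=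
    AvgEmbedding.coordSim_moments hk hU hin hout hν hμ hσ hσν hγ hκ
  obtain ⟨-, -, -, hpearson⟩ := AvgEmbedding.raw_moments hν hμ hσ hσν hγ hκ
  set m : Measure (Fin N → ℝ) := Measure.pi fun _ => ν
  set A := AvgEmbedding.coordSim U iin
  set B := AvgEmbedding.coordSim U iout
  have mA : Measurable A := AvgEmbedding.measurable_coordSim _ _
  have mB : Measurable B := AvgEmbedding.measurable_coordSim _ _
  have hk2 : (2 : ℝ) ≤ k := by exact_mod_cast hk
  have hk0 : (0 : ℝ) < k := by linarith
  let ξ : ∀ d, Fin d → Ω d → Fin N → ℝ := fun d j ω l => X d l ω j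
  have hξ : ∀ d, iIndepFun (ξ d) (P d) := fun d => (hX d).iIndepFun_column
  have hl : ∀ d j, HasLaw (ξ d j) m (P d) := fun d j => (hX d).hasLaw_column j
  obtain rfl : sIn = fun d ω => ∑ j, A (ξ d j ω) := by
    funext d ω
    rw [hsIn, AvgEmbedding.simToCenter_eq_sum]
  obtain rfl : sOut = fun d ω => ∑ j, B (ξ d j ω) := by
    funext d ω
    rw [hsOut, AvgEmbedding.simToCenter_eq_sum]
  clear hsIn hsOut
  have EA : ∀ d, ∫ ω, ∑ j, A (ξ d j ω) ∂(P d) = d * ∫ x, A x ∂m := fun d =>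
    AvgEmbedding.integral_sum_comp (hl d) (LA.integrable one_le_two)
  have EB : ∀ d, ∫ ω, ∑ j, B (ξ d j ω) ∂(P d) = d * ∫ x, B x ∂m := fun d =>
    AvgEmbedding.integral_sum_comp (hl d) (LB.integrable one_le_two)
  have SA : ∀ d, MemLp (fun ω => ∑ j, A (ξ d j ω)) 2 (P d) := fun d =>
    AvgEmbedding.memLp_sum_comp (hl d) LA
  have SB : ∀ d, MemLp (fun ω => ∑ j, B (ξ d j ω)) 2 (P d) := fun d =>
    AvgEmbedding.memLp_sum_comp (hl d) LB
  have VA : ∀ d, Var[fun ω => ∑ j, A (ξ d j ω); P d] = d * Var[A; m] := fun d => by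
    rw [← covariance_self (SA d).aemeasurable, ← covariance_self mA.aemeasurable,
      AvgEmbedding.covariance_sum_comp (hξ d) (hl d) LA LA mA mA]
  have VB : ∀ d, Var[fun ω => ∑ j, B (ξ d j ω); P d] = d * Var[B; m] := fun d => by
    rw [← covariance_self (SB d).aemeasurable, ← covariance_self mB.aemeasurable,
      AvgEmbedding.covariance_sum_comp (hξ d) (hl d) LB LB mB mB]
  have CAB : ∀ d, cov[fun ω => ∑ j, A (ξ d j ω), fun ω => ∑ j, B (ξ d j ω); P d]
      = d * cov[A, B; m] := fun d =>
    AvgEmbedding.covariance_sum_comp (hξ d) (hl d) LA LB mA mB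
  -- After completing the square, Pearson's inequality handles the `κ` term and `k ≥ 2` makes `(k -
  -- 1)σ²` strictly positive. `D` below is treated likewise.
  have vApos : 0 < Var[A; m] := by
    rw [vA, show (k : ℝ) * (k + 3) * μ ^ 2 * σ ^ 2 + 2 * (k + 1) * μ * γ * σ ^ 3
        + (κ + k - 2) * σ ^ 4 = σ ^ 2 * ((μ * (k + 1) + γ * σ) ^ 2 + (k - 1) * μ ^ 2
        + (κ - (γ ^ 2 + 1)) * σ ^ 2 + (k - 1) * σ ^ 2) by ring]
    have h1 : 0 ≤ (κ - (γ ^ 2 + 1)) * σ ^ 2 := mul_nonneg (by linarith) (by positivity)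
    have h2 : 0 ≤ ((k : ℝ) - 1) * μ ^ 2 := mul_nonneg (by linarith) (by positivity)
    have h3 : 0 < ((k : ℝ) - 1) * σ ^ 2 := mul_pos (by linarith) (by positivity)
    have h4 := sq_nonneg (μ * ((k : ℝ) + 1) + γ * σ)
    have h5 : 0 < (μ * ((k : ℝ) + 1) + γ * σ) ^ 2 + (k - 1) * μ ^ 2
        + (κ - (γ ^ 2 + 1)) * σ ^ 2 + (k - 1) * σ ^ 2 := by linarith
    positivity
  have vBpos : 0 < Var[B; m] := by
    rw [vB]
    positivity
  have hDpos : 0 < (2 * ((k : ℝ) - 1) + κ) * σ ^ 2 + 2 * k * γ * μ * σ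
      + 2 * (k : ℝ) ^ 2 * μ ^ 2 := by
    rw [show (2 * ((k : ℝ) - 1) + κ) * σ ^ 2 + 2 * k * γ * μ * σ + 2 * (k : ℝ) ^ 2 * μ ^ 2
      = (k * μ + γ * σ) ^ 2 + (k * μ) ^ 2 + (κ - (γ ^ 2 + 1)) * σ ^ 2
        + (2 * k - 1) * σ ^ 2 by ring]
    have h1 : 0 ≤ (κ - (γ ^ 2 + 1)) * σ ^ 2 := mul_nonneg (by linarith) (by positivity)
    have h3 : 0 < (2 * (k : ℝ) - 1) * σ ^ 2 := mul_pos (by linarith) (by positivity)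
    have h4 := sq_nonneg ((k : ℝ) * μ + γ * σ)
    have h5 := sq_nonneg ((k : ℝ) * μ)
    linarith
  set D := (2 * ((k : ℝ) - 1) + κ) * σ ^ 2 + 2 * k * γ * μ * σ + 2 * (k : ℝ) ^ 2 * μ ^ 2 with hD
  have joint := AvgEmbedding.tendstoInDistribution_pair hξ hl LA LB mA mB
  have hM := AvgEmbedding.posSemidef_covariance LA LB
  -- Both one-dimensional limits follow from the joint one by continuous mapping to a normalised
  -- coordinate.
  have marg : ∀ (i : Fin 2) (v : ℝ), 0 < v →
      (!![Var[A; m], cov[A, B; m]; cov[A, B; m], Var[B; m]] : Matrix _ _ ℝ) i i = v →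
      TendstoInDistribution (fun (d : ℕ) ω => ((Real.sqrt d)⁻¹ •
        !₂[∑ j, A (ξ d j ω) - d * ∫ x, A x ∂m, ∑ j, B (ξ d j ω) - d * ∫ x, B x ∂m]) i
          / Real.sqrt v) atTop (id : ℝ → ℝ) P (gaussianReal 0 1) := by
    rintro i v hv rfl
    exact (joint.continuous_comp (g := fun x : EuclideanSpace ℝ (Fin 2) => x i / _)
      (by fun_prop)).of_hasLaw (AvgEmbedding.hasLaw_eval_div_sqrt hM i hv)
  have formula : ∀ d : ℕ, 1 ≤ d → AvgEmbedding.approxProbGT (P d)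
      (fun ω => ∑ j, A (ξ d j ω)) (fun ω => ∑ j, B (ξ d j ω))
      = 1 / 2 * (1 + AvgEmbedding.erf (Real.sqrt (d * σ ^ 2 / (2 * D)))) := by
    intro d hd
    have hd0 : (0 : ℝ) < d := by exact_mod_cast hd
    have hvar : Var[fun ω => ∑ j, A (ξ d j ω); P d]
        - 2 * cov[fun ω => ∑ j, A (ξ d j ω), fun ω => ∑ j, B (ξ d j ω); P d]
        + Var[fun ω => ∑ j, B (ξ d j ω); P d] = d * σ ^ 2 * D / k ^ 2 := by
      rw [VA, VB, CAB, vA, vB, cAB, hD]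
      field_simp
      ring
    -- The difference of means is nonnegative, so the quotient `a / √b` can be moved under one root
    -- as `√(a² / b)`.
    rw [AvgEmbedding.approxProbGT_eq (SA d) (SB d) (by rw [hvar]; positivity), hvar, EA, EB, iA, iB,
      AvgEmbedding.div_sqrt_eq_sqrt (by ring_nf; positivity)]
    congr 4
    field_simp
    ring
  refine ⟨fun d => ⟨SA d, SB d, ?_, ?_, ?_, ?_, ?_⟩, fun d hd => ⟨?_, ?_⟩, ?_, ?_, ?_,
    fun d hd => ?_, ?_⟩
  · rw [EA, iA]
  · rw [VA, vA, mul_div_assoc]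
  · rw [EB, iB]
  · rw [VB, vB, mul_div_assoc]
  · rw [CAB, cAB, mul_div_assoc]
  · have hd0 : (0 : ℝ) < d := by exact_mod_cast hd
    rw [VA]
    positivity
  · have hd0 : (0 : ℝ) < d := by exact_mod_cast hd
    rw [VB]
    positivity
  · convert marg 0 _ vApos rfl using 3 with d ω
    -- The two normalisations agree also at `d = 0`, where both divide by zero.
    rw [EA, VA, Real.sqrt_mul d.cast_nonneg]
    simp
    ring
  · convert marg 1 _ vBpos rfl using 3 with d ω
    rw [EB, VB, Real.sqrt_mul d.cast_nonneg]
    simp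
    ring
  · rw [← vA, ← vB, ← cAB]
    simp only [EA, EB]
    exact joint
  · have hd0 : (0 : ℝ) < d := by exact_mod_cast hd
    have hpos : 0 < d * σ ^ 2 / (2 * D) := by positivity
    refine ⟨hpos, formula d hd, ?_⟩
    have herf := AvgEmbedding.erf_strictMono (Real.sqrt_pos.2 hpos)
    rw [AvgEmbedding.erf_zero] at herf
    rw [formula d hd]
    linarith
  · intro a ha b hb hab
    have hab' : (a : ℝ) < b := by exact_mod_cast hab
    have herf : AvgEmbedding.erf (Real.sqrt (a * σ ^ 2 / (2 * D)))
        < AvgEmbedding.erf (Real.sqrt (b * σ ^ 2 / (2 * D))) :=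
      AvgEmbedding.erf_strictMono (Real.sqrt_lt_sqrt (by positivity) (by gcongr))
    simp only [formula a ha, formula b hb]
    linarith
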